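/- Let $q$ be a prime power, let $\overline{\mathbb{F}_q(T)}$ be an algebraic closure of $\mathbb{F}_q(T)$, and for $M=\sum_k a_kT^k\in\mathbb{F}_q[T]$ and $u\in\overline{\mathbb{F}_q(T)}$ let $u_q^M=\sum_k a_k(\phi_q+\mu_T)^k(u)$ be the Carlitz action, where $\phi_q(u)=u^q$ and $\mu_T(u)=Tu$. Put $\Lambda_{q,M}=\{u\in\overline{\mathbb{F}_q(T)} : u_q^M=0\}$ and $\mathbb{T}_q=\bigcup_{M\neq 0}\Lambda_{q,M}$. Fix a place $\mathfrak{P}$ of $\overline{\mathbb{F}_q(T)}$ above the infinite place of $\mathbb{F}_q(T)$, let $v_\mathfrak{P}$ be its valuation, normalized by $v_\mathfrak{P}(r)=-(q-1)\deg r$ for nonzero $r\in\mathbb{F}_q(T)$, and extend $v_\mathfrak{P}$ to the completion at $\mathfrak{P}$. Let $\mathbb{S}_q$ be the completion of $\mathbb{T}_q$ at $\mathfrak{P}$, i.e. the closure of $\mathbb{T}_q$ in that completion. Let $\lambda^*\in\mathbb{S}_q\setminus\mathbb{T}_q$. (1) (Dirichlet approximation theorem) There is an integer $i\ge 0$ with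 $v_\mathfrak{P}(\lambda^*)=i(q-1)-1$, and for this $i$ and each integer $n\ge i+1$ there exist $M_n\in\mathbb{F}_q[T]$ with $\deg M_n=n$ and $\lambda_n\in\Lambda_{q,M_n}$ such that $$v_\mathfrak{P}(\lambda_n-\lambda^*)>(n-1)(q-1)-1.$$ (2) If $(\lambda_n)_{n\in\mathbb{N}}$ is a sequence in $\mathbb{T}_q$ that converges to $\lambda^*$ at $\mathfrak{P}$, and $A_n\in\mathbb{F}_q[T]\setminus\{0\}$ are such that $\lambda_n\in\Lambda_{q,A_n}$ for each $n$, then $\lim_{n\to\infty}\deg(A_n)=\infty$. -/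

import Mathlib

open Polynomial Filter Topology

noncomputable section

namespace QCircle

variable (F : Type*) [Field F] [Fintype F]

/-- An algebraic closure of the rational function field `𝔽_q(T)`, where `F = 𝔽_q`. -/
abbrev Kbar : Type _ := AlgebraicClosure (RatFunc F)

/-- The variable `T`, seen in the algebraic closure of `𝔽_q(T)`. -/
def T : Kbar F := algebraMap (RatFunc F) (Kbar F) RatFunc.X

/-- The operator `φ_q + μ_T : u ↦ u ^ q + T * u`, an `𝔽_q`-linear endomorphism of the algebraic
closure of `𝔽_q(T)`. -/
def carlitzT : Module.End F (Kbar F) :=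
  (FiniteField.frobeniusAlgHom F (Kbar F)).toLinearMap + LinearMap.mulLeft F (T F)

variable {F}

/-- The Carlitz action `u_q^M = ∑ a_k (φ_q + μ_T)^k (u)` of a polynomial `M = ∑ a_k T^k`. -/
def carlitz (M : F[X]) (u : Kbar F) : Kbar F := aeval (carlitzT F) M u

/-- The set `Λ_{q,M}` of `M`-torsion points of the Carlitz action. -/
def torsion (M : F[X]) : Set (Kbar F) := {u | carlitz M u = 0}

variable (F) in
/-- The set `𝕋_q` of all roots of `q`-unity: the union of the `Λ_{q,M}` over all `M ≠ 0`. -/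
def allTorsion : Set (Kbar F) := ⋃ (M : F[X]) (_ : M ≠ 0), torsion M

variable (F) in
/-- A branch `𝔓` of infinity: a place of the algebraic closure of `𝔽_q(T)` above the infinite
place of `𝔽_q(T)`. Each such place is given by its unique absolute value that extends the absolute
value `|r| = q ^ deg r` of `𝔽_q(T)`. -/
structure InftyPlace where
  abv : AbsoluteValue (Kbar F) ℝ
  nonarch : IsNonarchimedean abv
  extends_infty : ∀ r : RatFunc F, r ≠ 0 →
    abv (algebraMap (RatFunc F) (Kbar F) r) = (Fintype.card F : ℝ) ^ r.intDegree

namespace InftyPlace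

variable (P : InftyPlace F)

/-- The completion at `𝔓` of the algebraic closure of `𝔽_q(T)`. -/
abbrev Completion : Type _ := P.abv.Completion

/-- The embedding of the algebraic closure of `𝔽_q(T)` into its completion at `𝔓`. -/
def emb (u : Kbar F) : P.Completion := (WithAbs.toAbs P.abv u : P.abv.Completion)

/-- The set `𝕋_q`, seen in the completion at `𝔓`. -/
def T_q : Set P.Completion := P.emb '' allTorsion F

/-- The `q`-unit circle `𝕊_q`: the completion of `𝕋_q` at `𝔓`, that is, the closure of `𝕋_q` in the
complete field. -/
def S_q : Set P.Completion := closure P.T_q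

/-- The additive valuation `v_𝔓`, with `v_𝔓(0) = ∞` and normalized by `v_𝔓(r) = -(q - 1) deg r` for
nonzero `r` in `𝔽_q(T)` (the ramification index of `𝔓` over the infinite place being `q - 1` in the
field generated by `𝕊_q`). As the absolute value of `r` is `q ^ deg r`, this is
`-(q - 1) log_q |x|`. -/
def ord (x : P.Completion) : WithTop ℝ :=
  open scoped Classical in
  if x = 0 then ⊤
  else ((-((Fintype.card F : ℝ) - 1) * Real.logb (Fintype.card F) ‖x‖ : ℝ) : WithTop ℝ)

end InftyPlace

end QCircle

end

namespace QCircle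

/-! ### Algebra of the Carlitz action. -/

section Carlitz

variable {F : Type*} [Field F] [Fintype F]

/-! Write `q` for the cardinality of `F` and `ρ = q ^ (1 / (q - 1))`. Since `|T| = q`, the operator
`u ↦ u ^ q + T u` multiplies sizes by `q` inside `|u| < ρ` and raises them to the power `q` outside
`|u| ≤ ρ`. Orbits starting outside grow, so torsion lies in `|u| ≤ ρ`. The orbit of a nonzero
torsion point must hit `|u| = ρ` exactly, so its size is `ρ / q ^ i`; such sizes pass to limits.

For (1), `M_n = X ^ n` works. If `u` is torsion, then `w = carlitz (X ^ n) u` has `|w| ≤ ρ`, and `w`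
has a preimage `d` with `|d| = |w| / q ^ n` (`exists_carlitzT_pow_eq`). Then `u - d` is `X ^
n`-torsion and close to `u`.

For (2), torsion of bounded degree is uniformly discrete (`eq_zero_of_mem_torsion`), so a limit
along bounded degrees is itself a torsion point. -/

theorem carlitzT_apply (u : Kbar F) : carlitzT F u = u ^ Fintype.card F + T F * u := rfl

theorem carlitz_X_pow (n : ℕ) (u : Kbar F) : carlitz (X ^ n) u = (carlitzT F ^ n) u := by
  simp [carlitz]

theorem carlitz_mul (M N : F[X]) (u : Kbar F) : carlitz (M * N) u = carlitz M (carlitz N u) := by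
  simp [carlitz]

theorem carlitz_sub (M : F[X]) (u v : Kbar F) : carlitz M (u - v) = carlitz M u - carlitz M v :=
  map_sub _ _ _

theorem carlitz_zero (M : F[X]) : carlitz M (0 : Kbar F) = 0 :=
  map_zero _

theorem carlitz_eq_sum (M : F[X]) (u : Kbar F) :
    carlitz M u = ∑ k ∈ Finset.range (M.natDegree + 1), M.coeff k • (carlitzT F ^ k) u := by
  rw [carlitz, aeval_eq_sum_range]
  simp [LinearMap.sum_apply]

theorem torsion_mul_left {M : F[X]} {u : Kbar F} (N : F[X]) (hu : u ∈ torsion M) :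
    u ∈ torsion (N * M) := by
  change carlitz _ _ = 0
  rw [carlitz_mul, show carlitz M u = 0 from hu, carlitz_zero]

theorem sub_mem_torsion_mul {M N : F[X]} {u v : Kbar F} (hu : u ∈ torsion M)
    (hv : v ∈ torsion N) : u - v ∈ torsion (M * N) := by
  have hu' : carlitz (M * N) u = 0 := mul_comm N M ▸ torsion_mul_left N hu
  have hv' : carlitz (M * N) v = 0 := torsion_mul_left M hv
  change carlitz _ _ = 0
  rw [carlitz_sub, hu', hv', sub_zero]

theorem carlitzT_pow_mem_torsion {M : F[X]} {u : Kbar F} (hu : u ∈ torsion M) (n : ℕ) :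
    (carlitzT F ^ n) u ∈ torsion M := by
  change carlitz _ _ = 0
  rw [← carlitz_X_pow, ← carlitz_mul, mul_comm, carlitz_mul, show carlitz M u = 0 from hu,
    carlitz_zero]

end Carlitz

/-! ### The critical radius. -/

section CritRadius

variable (F : Type*) [Field F] [Fintype F]

/-- The radius `q ^ (1 / (q - 1))` at which the two terms of `u ^ q + T * u` have the same size. -/
noncomputable def critRadius : ℝ := (Fintype.card F : ℝ) ^ (1 / ((Fintype.card F : ℝ) - 1))

theorem one_lt_card : (1 : ℝ) < Fintype.card F := mod_cast Fintype.one_lt_card (α := F)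

theorem one_lt_critRadius : 1 < critRadius F :=
  Real.one_lt_rpow (one_lt_card F) (by have := one_lt_card F; exact one_div_pos.2 (by linarith))

theorem critRadius_pos : 0 < critRadius F := one_pos.trans (one_lt_critRadius F)

theorem critRadius_pow_pred : critRadius F ^ (Fintype.card F - 1) = Fintype.card F := by
  have h := one_lt_card F
  rw [critRadius, ← Real.rpow_natCast, ← Real.rpow_mul (by linarith),
    Nat.cast_sub Fintype.card_pos, Nat.cast_one, one_div_mul_cancel (by linarith), Real.rpow_one]

theorem pow_card_eq (x : ℝ) : x ^ Fintype.card F = x ^ (Fintype.card F - 1) * x := by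
  rw [← pow_succ, Nat.sub_add_cancel Fintype.card_pos]

theorem pow_card_lt_iff {x : ℝ} (hx : 0 < x) :
    x ^ Fintype.card F < Fintype.card F * x ↔ x < critRadius F := by
  have h : Fintype.card F - 1 ≠ 0 := Nat.sub_ne_zero_of_lt Fintype.one_lt_card
  rw [pow_card_eq, mul_lt_mul_iff_left₀ hx]
  conv_lhs => rw [← critRadius_pow_pred F]
  exact pow_lt_pow_iff_left₀ hx.le (critRadius_pos F).le h

theorem lt_pow_card_iff {x : ℝ} (hx : 0 < x) :
    Fintype.card F * x < x ^ Fintype.card F ↔ critRadius F < x := by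
  have h : Fintype.card F - 1 ≠ 0 := Nat.sub_ne_zero_of_lt Fintype.one_lt_card
  rw [pow_card_eq, mul_lt_mul_iff_left₀ hx]
  conv_lhs => rw [← critRadius_pow_pred F]
  exact pow_lt_pow_iff_left₀ (critRadius_pos F).le hx.le h

theorem logb_critRadius : Real.logb (Fintype.card F) (critRadius F)
    = 1 / ((Fintype.card F : ℝ) - 1) :=
  have h := one_lt_card F
  Real.logb_rpow (by linarith) h.ne'

end CritRadius

/-! ### Sizes of torsion points and of preimages under the operator. -/

namespace InftyPlace

variable {F : Type*} [Field F] [Fintype F] (P : InftyPlace F)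

theorem abv_T : P.abv (T F) = Fintype.card F := by
  rw [T, P.extends_infty _ RatFunc.X_ne_zero, RatFunc.intDegree_X, zpow_one]

theorem abv_smul {a : F} (ha : a ≠ 0) (u : Kbar F) : P.abv (a • u) = P.abv u := by
  rw [Algebra.smul_def, map_mul, IsScalarTower.algebraMap_apply F (RatFunc F) (Kbar F),
    P.extends_infty _ (by simpa using ha), RatFunc.algebraMap_eq_C, RatFunc.intDegree_C, zpow_zero,
    one_mul]

theorem abv_smul_le (a : F) (u : Kbar F) : P.abv (a • u) ≤ P.abv u := by
  rcases eq_or_ne a 0 with rfl | ha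
  · simp
  · exact (P.abv_smul ha u).le

theorem abv_carlitzT_of_lt {u : Kbar F} (hu : P.abv u < critRadius F) :
    P.abv (carlitzT F u) = Fintype.card F * P.abv u := by
  rcases eq_or_ne u 0 with rfl | h0
  · simp
  have h : P.abv (u ^ Fintype.card F) < P.abv (T F * u) := by
    rw [map_pow, map_mul, P.abv_T]
    exact (pow_card_lt_iff F (P.abv.pos h0)).2 hu
  rw [carlitzT_apply, IsNonarchimedean.add_eq_right_of_lt P.nonarch h, map_mul, P.abv_T]

theorem abv_carlitzT_of_gt {u : Kbar F} (hu : critRadius F < P.abv u) :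
    P.abv (carlitzT F u) = P.abv u ^ Fintype.card F := by
  have h : P.abv (T F * u) < P.abv (u ^ Fintype.card F) := by
    rw [map_pow, map_mul, P.abv_T]
    exact (lt_pow_card_iff F ((critRadius_pos F).trans hu)).2 hu
  rw [carlitzT_apply, IsNonarchimedean.add_eq_left_of_lt P.nonarch h, map_pow]

/-- Only the argument of the last application must lie below the critical radius, which gives the
extra factor `q` in the bound. -/
theorem abv_carlitzT_pow (n : ℕ) {u : Kbar F}
    (hu : (Fintype.card F : ℝ) ^ n * P.abv u < Fintype.card F * critRadius F) :
    P.abv ((carlitzT F ^ n) u) = (Fintype.card F : ℝ) ^ n * P.abv u := by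
  have hq := one_lt_card F
  induction n with
  | zero => simp
  | succ n ih =>
    have h1 : (Fintype.card F : ℝ) ^ n * P.abv u < critRadius F := by
      rw [pow_succ', mul_assoc] at hu
      exact lt_of_mul_lt_mul_left hu (by linarith)
    have h2 := ih (h1.trans (lt_mul_of_one_lt_left (critRadius_pos F) hq))
    rw [pow_succ', Module.End.mul_apply, P.abv_carlitzT_of_lt (h2 ▸ h1), h2, pow_succ', mul_assoc]

/-- If the last term of `∑ a_k (φ + μ_T)^k (u)` strictly dominates, `carlitz M u` has its size. -/
theorem abv_carlitz {M : F[X]} (hM : M ≠ 0) {u : Kbar F}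
    (h : ∀ k < M.natDegree, P.abv ((carlitzT F ^ k) u) < P.abv ((carlitzT F ^ M.natDegree) u)) :
    P.abv (carlitz M u) = P.abv ((carlitzT F ^ M.natDegree) u) := by
  have hl := P.abv_smul (leadingCoeff_ne_zero.2 hM) ((carlitzT F ^ M.natDegree) u)
  rw [carlitz_eq_sum, ← hl]
  refine IsNonarchimedean.apply_sum_eq_of_lt P.nonarch (fun x => (P.abv.map_neg x).symm)
    (Finset.self_mem_range_succ _) fun k hk hne => ?_
  rw [leadingCoeff] at hl
  rw [hl]
  refine (P.abv_smul_le _ _).trans_lt (h k ?_)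
  have := Finset.mem_range.1 hk
  omega

/-- All iterates up to the degree scale linearly, so for `u ≠ 0` the top term strictly dominates and
cannot cancel. -/
theorem eq_zero_of_mem_torsion {M : F[X]} (hM : M ≠ 0) {u : Kbar F} (hu : u ∈ torsion M)
    (h : (Fintype.card F : ℝ) ^ M.natDegree * P.abv u < Fintype.card F * critRadius F) :
    u = 0 := by
  by_contra h0
  have hq := one_lt_card F
  have hpos := P.abv.pos h0
  have key : ∀ k ≤ M.natDegree,
      P.abv ((carlitzT F ^ k) u) = (Fintype.card F : ℝ) ^ k * P.abv u := fun k hk =>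
    P.abv_carlitzT_pow k (lt_of_le_of_lt (by gcongr; exact hq.le) h)
  have := P.abv_carlitz hM (u := u) fun k hk => by
    rw [key k hk.le, key _ le_rfl]
    gcongr
  rw [show carlitz M u = 0 from hu, key _ le_rfl, map_zero] at this
  have : 0 < (Fintype.card F : ℝ) ^ M.natDegree * P.abv u := by positivity
  linarith

/-- Beyond the critical radius the iterates grow strictly, so the top term of `carlitz M u`
dominates and is nonzero. -/
theorem abv_le_of_mem_torsion {M : F[X]} (hM : M ≠ 0) {u : Kbar F} (hu : u ∈ torsion M) :
    P.abv u ≤ critRadius F := by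
  by_contra! h
  have hρ := one_lt_critRadius F
  have hk : ∀ k, critRadius F < P.abv ((carlitzT F ^ k) u) := by
    intro k
    induction k with
    | zero => simpa using h
    | succ k ih =>
      rw [pow_succ', Module.End.mul_apply, P.abv_carlitzT_of_gt ih]
      exact ih.trans (lt_self_pow₀ (hρ.trans ih) Fintype.one_lt_card)
  have hmono : StrictMono fun k => P.abv ((carlitzT F ^ k) u) := by
    refine strictMono_nat_of_lt_succ fun k => ?_
    rw [pow_succ', Module.End.mul_apply, P.abv_carlitzT_of_gt (hk k)]
    exact lt_self_pow₀ (hρ.trans (hk k)) Fintype.one_lt_card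
  have := P.abv_carlitz hM (u := u) fun k hk => hmono hk
  rw [show carlitz M u = 0 from hu, map_zero] at this
  linarith [hk M.natDegree]

/-- The possible sizes of the nonzero torsion points of the Carlitz action. -/
theorem exists_abv_eq_of_mem_torsion {M : F[X]} (hM : M ≠ 0) {u : Kbar F} (hu : u ∈ torsion M)
    (h0 : u ≠ 0) : ∃ i : ℕ, (Fintype.card F : ℝ) ^ i * P.abv u = critRadius F := by
  by_contra! hne
  have hq := one_lt_card F
  have hlt : ∀ i : ℕ, (Fintype.card F : ℝ) ^ i * P.abv u < critRadius F := by
    intro i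
    induction i with
    | zero => exact lt_of_le_of_ne (by simpa using P.abv_le_of_mem_torsion hM hu) (hne 0)
    | succ i ih =>
      refine lt_of_le_of_ne ?_ (hne _)
      -- This is the size of an iterate, which is again a torsion point and hence in the disc.
      rw [← P.abv_carlitzT_pow]
      · exact P.abv_le_of_mem_torsion hM (carlitzT_pow_mem_torsion hu _)
      · rw [pow_succ', mul_assoc]
        gcongr
  exact h0 (P.eq_zero_of_mem_torsion hM hu
    ((hlt _).trans (lt_mul_of_one_lt_left (critRadius_pos F) hq)))

/-- The `q` roots of `X ^ q + T X - w` have product of size `|w| ≤ ρ < ρ ^ q`, so one of them has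
size below `ρ`, where the operator scales by `q`. -/
theorem exists_carlitzT_eq {w : Kbar F} (hw : P.abv w ≤ critRadius F) :
    ∃ d, carlitzT F d = w ∧ Fintype.card F * P.abv d = P.abv w := by
  have hq : 1 < Fintype.card F := Fintype.one_lt_card
  have hρ := one_lt_critRadius F
  suffices ∃ d, carlitzT F d = w ∧ P.abv d < critRadius F by
    obtain ⟨d, hd, hlt⟩ := this
    exact ⟨d, hd, by rw [← P.abv_carlitzT_of_lt hlt, hd]⟩
  by_contra! hge
  set p : (Kbar F)[X] := X ^ Fintype.card F + (C (T F) * X - C w) with hp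
  have hdeg : (C (T F) * X - C w).degree < ((Fintype.card F : ℕ) : WithBot ℕ) := by
    refine lt_of_le_of_lt (b := ((1 : ℕ) : WithBot ℕ)) ?_ (Nat.cast_lt.2 hq)
    compute_degree
    exact le_rfl
  have hmon : p.Monic := monic_X_pow_add hdeg
  have hnat : p.natDegree = Fintype.card F :=
    by
    rw [hp, natDegree_add_eq_left_of_degree_lt (by rwa [degree_X_pow]), natDegree_X_pow]
  have hs : p.Splits := IsAlgClosed.splits p
  have hroot : ∀ d ∈ p.roots, critRadius F ≤ P.abv d := by
    intro d hd
    refine hge d ?_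
    have := (mem_roots hmon.ne_zero).1 hd
    simp only [hp, IsRoot.def, eval_add, eval_sub, eval_pow, eval_X, eval_mul, eval_C] at this
    rw [carlitzT_apply]
    linear_combination this
  have hprod : ∀ s : Multiset (Kbar F), (∀ d ∈ s, critRadius F ≤ P.abv d) →
      critRadius F ^ s.card ≤ P.abv s.prod := by
    intro s
    induction s using Multiset.induction_on with
    | empty => simp
    | cons a s ih =>
      intro h
      rw [Multiset.card_cons, Multiset.prod_cons, map_mul, pow_succ']
      have h1 := h a (Multiset.mem_cons_self a s)
      have h2 := ih fun d hd => h d (Multiset.mem_cons_of_mem hd)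
      gcongr
  have h1 := hprod _ hroot
  have h2 := congrArg P.abv (hs.coeff_zero_eq_prod_roots_of_monic hmon)
  have h3 : p.coeff 0 = -w := by
    simp [hp, coeff_X_pow, Fintype.card_ne_zero.symm]
  rw [h3, map_mul, P.abv.map_neg, map_pow, P.abv.map_neg, map_one, one_pow, one_mul] at h2
  rw [← hs.natDegree_eq_card_roots, hnat, ← h2] at h1
  exact absurd (h1.trans hw) (lt_self_pow₀ hρ hq).not_ge

theorem exists_carlitzT_pow_eq (n : ℕ) {w : Kbar F} (hw : P.abv w ≤ critRadius F) :
    ∃ d, (carlitzT F ^ n) d = w ∧ (Fintype.card F : ℝ) ^ n * P.abv d = P.abv w := by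
  induction n with
  | zero => exact ⟨w, by simp⟩
  | succ n ih =>
    obtain ⟨d, hd, hd'⟩ := ih
    have hle : P.abv d ≤ P.abv w := by
      rw [← hd']
      exact le_mul_of_one_le_left (P.abv.nonneg d) (one_le_pow₀ (one_lt_card F).le)
    obtain ⟨e, he, he'⟩ := P.exists_carlitzT_eq (hle.trans hw)
    exact ⟨e, by rw [pow_succ, Module.End.mul_apply, he, hd],
      by rw [pow_succ, mul_assoc, he', hd']⟩

/-- Every torsion point is approximated by a `T ^ n`-torsion point. -/
theorem exists_torsion_X_pow_near {M : F[X]} (hM : M ≠ 0) {u : Kbar F} (hu : u ∈ torsion M)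
    (n : ℕ) : ∃ v ∈ torsion (X ^ n : F[X]),
      (Fintype.card F : ℝ) ^ n * P.abv (v - u) ≤ critRadius F := by
  have hw := P.abv_le_of_mem_torsion hM (carlitzT_pow_mem_torsion hu n)
  obtain ⟨d, hd, hd'⟩ := P.exists_carlitzT_pow_eq n hw
  refine ⟨u - d, ?_, ?_⟩
  · change carlitz _ _ = 0
    rw [carlitz_X_pow, map_sub, hd, sub_self]
  · rw [sub_sub_cancel_left, P.abv.map_neg, hd']
    exact hw

/-! ### Transfer to the completion. -/

theorem norm_emb (u : Kbar F) : ‖P.emb u‖ = P.abv u :=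
  UniformSpace.Completion.norm_coe _

theorem emb_sub (u v : Kbar F) : P.emb (u - v) = P.emb u - P.emb v :=
  UniformSpace.Completion.coe_sub (WithAbs.toAbs P.abv u) (WithAbs.toAbs P.abv v)

theorem norm_emb_sub (u v : Kbar F) : ‖P.emb u - P.emb v‖ = P.abv (u - v) := by
  rw [← emb_sub, norm_emb]

theorem ord_of_ne_zero {x : P.Completion} (hx : x ≠ 0) :
    P.ord x = ((-((Fintype.card F : ℝ) - 1) * Real.logb (Fintype.card F) ‖x‖ : ℝ) : WithTop ℝ) :=
  if_neg hx

theorem logb_card_pow_mul (n : ℕ) {x : ℝ} (hx : 0 < x) :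
    Real.logb (Fintype.card F) ((Fintype.card F : ℝ) ^ n * x)
      = n + Real.logb (Fintype.card F) x := by
  have hq := one_lt_card F
  rw [Real.logb_mul (by positivity) hx.ne', Real.logb_pow, Real.logb_self_eq_one hq, mul_one]

/-- The critical radius has order `-1`, and dividing the norm by `q` adds `q - 1`. -/
theorem ord_eq_of_norm {x : P.Completion} (hx : x ≠ 0) {i : ℕ}
    (h : (Fintype.card F : ℝ) ^ i * ‖x‖ = critRadius F) :
    P.ord x = (((i : ℝ) * ((Fintype.card F : ℝ) - 1) - 1 : ℝ) : WithTop ℝ) := by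
  have hq := one_lt_card F
  have h1 := logb_card_pow_mul (F := F) i (norm_pos_iff.2 hx)
  rw [h, logb_critRadius] at h1
  have h2 : (Fintype.card F : ℝ) - 1 ≠ 0 := by linarith
  rw [P.ord_of_ne_zero hx, WithTop.coe_inj, ← sub_eq_iff_eq_add'.2 h1]
  field_simp
  ring

theorem lt_ord_of_norm {x : P.Completion} {n : ℕ}
    (h : (Fintype.card F : ℝ) ^ n * ‖x‖ < Fintype.card F * critRadius F) :
    ((((n : ℝ) - 1) * ((Fintype.card F : ℝ) - 1) - 1 : ℝ) : WithTop ℝ) < P.ord x := by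
  rcases eq_or_ne x 0 with rfl | hx
  · rw [ord, if_pos rfl]
    exact WithTop.coe_lt_top _
  have hq := one_lt_card F
  have hpos := norm_pos_iff.2 hx
  have h1 := logb_card_pow_mul (F := F) n hpos
  have h2 := logb_card_pow_mul (F := F) 1 (critRadius_pos F)
  rw [pow_one, logb_critRadius] at h2
  have h3 := Real.logb_lt_logb hq (by positivity) h
  rw [h1, h2] at h3
  rw [P.ord_of_ne_zero hx, WithTop.coe_lt_coe]
  have h4 : 0 < (Fintype.card F : ℝ) - 1 := by linarith
  have h5 := mul_lt_mul_of_pos_left h3 h4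
  have h6 : ((Fintype.card F : ℝ) - 1) * (1 / ((Fintype.card F : ℝ) - 1)) = 1 :=
    mul_one_div_cancel h4.ne'
  push_cast at h5
  linarith

theorem mem_T_q {M : F[X]} (hM : M ≠ 0) {u : Kbar F} (hu : u ∈ torsion M) : P.emb u ∈ P.T_q :=
  ⟨u, Set.mem_iUnion₂.2 ⟨M, hM, hu⟩, rfl⟩

theorem zero_mem_T_q : (0 : P.Completion) ∈ P.T_q :=
  P.mem_T_q (M := 1) one_ne_zero (u := 0) (carlitz_zero _)

theorem exists_torsion_near {x : P.Completion} (hx : x ∈ P.S_q) {ε : ℝ} (hε : 0 < ε) :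
    ∃ M : F[X], M ≠ 0 ∧ ∃ u ∈ torsion M, ‖P.emb u - x‖ < ε := by
  obtain ⟨_, ⟨u, hu, rfl⟩, h⟩ := Metric.mem_closure_iff.1 hx ε hε
  obtain ⟨M, hM, huM⟩ := Set.mem_iUnion₂.1 hu
  exact ⟨M, hM, u, huM, by rwa [dist_comm, dist_eq_norm] at h⟩

theorem exists_norm_eq {x : P.Completion} (hx : x ∈ P.S_q) (h0 : x ≠ 0) :
    ∃ i : ℕ, (Fintype.card F : ℝ) ^ i * ‖x‖ = critRadius F := by
  have hpos := norm_pos_iff.2 h0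
  obtain ⟨M, hM, u, hu, hux⟩ := P.exists_torsion_near hx (half_pos hpos)
  have hbig : ∀ v, ‖P.emb v - x‖ < ‖x‖ / 2 → ‖x‖ / 2 < P.abv v := fun v hv => by
    rw [← norm_emb]
    have := norm_sub_norm_le x (P.emb v)
    rw [norm_sub_rev] at this
    linarith
  have hu0 : u ≠ 0 := by
    rintro rfl
    have := hbig 0 hux
    rw [map_zero] at this
    linarith
  suffices ‖x‖ = P.abv u by
    rw [this]
    exact P.exists_abv_eq_of_mem_torsion hM hu hu0
  -- A second approximant `v`, arbitrarily close to `x`, has the size of `u`: this way the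
  -- ultrametric inequality is needed only before completion.
  refine eq_of_forall_dist_le fun ε hε => ?_
  obtain ⟨N, -, v, -, hvx⟩ := P.exists_torsion_near hx (lt_min hε (sub_pos.2 hux))
  have h1 : P.abv (v - u) < P.abv u := by
    rw [← norm_emb_sub]
    have := norm_sub_le_norm_sub_add_norm_sub (P.emb v) x (P.emb u)
    rw [norm_sub_rev x] at this
    linarith [hvx.trans_le (min_le_right _ _), hbig u hux]
  have h2 : P.abv v = P.abv u := by
    have := IsNonarchimedean.add_eq_right_of_lt P.nonarch h1
    rwa [sub_add_cancel] at this
  rw [← h2, ← norm_emb, dist_comm, Real.dist_eq]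
  exact (abs_norm_sub_norm_le _ _).trans (hvx.trans_le (min_le_left _ _)).le

theorem exists_torsion_X_pow_ord_lt {x : P.Completion} (hx : x ∈ P.S_q) (n : ℕ) :
    ∃ u ∈ torsion (X ^ n : F[X]),
      ((((n : ℝ) - 1) * ((Fintype.card F : ℝ) - 1) - 1 : ℝ) : WithTop ℝ) < P.ord (P.emb u - x) := by
  have hq := one_lt_card F
  have hρ := critRadius_pos F
  have hq1 : 0 < (Fintype.card F : ℝ) - 1 := by linarith
  have hqn : 0 < (Fintype.card F : ℝ) ^ n := by positivity
  -- After scaling by `q ^ n`, this error `(q - 1) ρ` and the error `ρ` of the next step add up to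
  -- the allowed `q ρ`.
  obtain ⟨M, hM, v, hv, hvx⟩ := P.exists_torsion_near hx
    (ε := ((Fintype.card F : ℝ) - 1) * critRadius F / (Fintype.card F : ℝ) ^ n) (by positivity)
  obtain ⟨u, hu, huv⟩ := P.exists_torsion_X_pow_near hM hv n
  refine ⟨u, hu, P.lt_ord_of_norm ?_⟩
  rw [← norm_emb_sub] at huv
  rw [lt_div_iff₀' hqn] at hvx
  have := mul_le_mul_of_nonneg_left
    (norm_sub_le_norm_sub_add_norm_sub (P.emb u) (P.emb v) x) hqn.le
  linarith

theorem tendsto_natDegree {x : P.Completion} (hT : x ∉ P.T_q) {u : ℕ → Kbar F} {A : ℕ → F[X]}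
    (hA : ∀ n, A n ≠ 0) (hu : ∀ n, u n ∈ torsion (A n))
    (hlim : Tendsto (fun n => P.emb (u n)) atTop (𝓝 x)) :
    Tendsto (fun n => (A n).natDegree) atTop atTop := by
  have hq := one_lt_card F
  have hρ := critRadius_pos F
  refine tendsto_atTop.2 fun D => ?_
  by_contra hfreq
  -- Two terms of degree below `D` that are `ε`-close to `x` differ by at most `ε + ε`, and their
  -- difference is killed by a product of degree at most `D + D`; so they coincide.
  obtain ⟨ε, hε, hεD⟩ : ∃ ε > 0, (Fintype.card F : ℝ) ^ (D + D) * (ε + ε) <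
      Fintype.card F * critRadius F := by
    have hpos : 0 < (Fintype.card F : ℝ) ^ (D + D) := by positivity
    refine ⟨critRadius F / (Fintype.card F : ℝ) ^ (D + D) / 2, by positivity, ?_⟩
    rw [add_halves, mul_div_cancel₀ _ hpos.ne']
    exact lt_mul_of_one_lt_left hρ hq
  have hclose : ∀ᶠ n in atTop, ‖P.emb (u n) - x‖ < ε := by
    simpa [dist_eq_norm] using Metric.tendsto_nhds.1 hlim ε hε
  have hfr : ∃ᶠ n in atTop, (A n).natDegree < D ∧ ‖P.emb (u n) - x‖ < ε :=
    ((Filter.not_eventually.1 hfreq).mono fun n hn => not_le.1 hn).and_eventually hclose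
  obtain ⟨m, hmD, hmε⟩ := hfr.exists
  have heq : ∀ n, (A n).natDegree < D → ‖P.emb (u n) - x‖ < ε → u n = u m := by
    intro n hnD hnε
    refine sub_eq_zero.1 (P.eq_zero_of_mem_torsion (mul_ne_zero (hA n) (hA m))
      (sub_mem_torsion_mul (hu n) (hu m)) (lt_of_le_of_lt ?_ hεD))
    have h1 := norm_sub_le_norm_sub_add_norm_sub (P.emb (u n)) x (P.emb (u m))
    rw [norm_sub_rev x, norm_emb_sub] at h1
    have h2 : (A n * A m).natDegree ≤ D + D := natDegree_mul_le.trans (by omega)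
    have h3 : P.abv (u n - u m) ≤ ε + ε := by linarith
    gcongr
    exact hq.le
  refine hT (?_ : x ∈ P.T_q)
  -- The sequence takes the value `P.emb (u m)` infinitely often, so its limit is that value.
  have : x ∈ ({P.emb (u m)} : Set P.Completion) :=
    isClosed_singleton.mem_of_frequently_of_tendsto
      (hfr.mono fun n hn => congrArg P.emb (heq n hn.1 hn.2)) hlim
  exact this ▸ P.mem_T_q (hA m) (hu m)

end InftyPlace

end QCircle

theorem mainTheorem9 {F : Type*} [Field F] [Fintype F] (P : QCircle.InftyPlace F)
    (lam : P.Completion) (hS : lam ∈ P.S_q) (hT : lam ∉ P.T_q) :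
    (∃ i : ℕ,
      P.ord lam = (((i : ℝ) * ((Fintype.card F : ℝ) - 1) - 1 : ℝ) : WithTop ℝ) ∧
      ∀ n : ℕ, i + 1 ≤ n →
        ∃ M : F[X], M.degree = n ∧
          ∃ u ∈ QCircle.torsion M,
            ((((n : ℝ) - 1) * ((Fintype.card F : ℝ) - 1) - 1 : ℝ) : WithTop ℝ) <
              P.ord (P.emb u - lam)) ∧
    (∀ (u : ℕ → QCircle.Kbar F) (A : ℕ → F[X]),
      (∀ n, A n ≠ 0) → (∀ n, u n ∈ QCircle.torsion (A n)) →
      Tendsto (fun n => P.emb (u n)) atTop (𝓝 lam) →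
      Tendsto (fun n => (A n).natDegree) atTop atTop) := by
  have h0 : lam ≠ 0 := fun h => hT (h ▸ P.zero_mem_T_q)
  obtain ⟨i, hi⟩ := P.exists_norm_eq hS h0
  refine ⟨⟨i, P.ord_eq_of_norm h0 hi, fun n _ => ?_⟩, fun u A hA hu => P.tendsto_natDegree hT hA hu⟩
  obtain ⟨u, hu, h⟩ := P.exists_torsion_X_pow_ord_lt hS n
  exact ⟨X ^ n, degree_X_pow n, u, hu, h⟩
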